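/- Let $\mathbb{H}$ be the skew field of quaternions with its Euclidean topology, on which $\mathbb{H}^*=\mathbb{H}\setminus\{0\}$ acts by ${}^{a}q=aqa^{-1}$; let $O(q)$ be the orbit of $q$. A region is an open subset of $\mathbb{H}$ that is invariant under this action (it may be empty or disconnected). For $\mathbb{H}$-valued functions $F,G$ on an invariant set $X\subset\mathbb{H}$, the skew product is $$(F\diamond G)(q)=\begin{cases}F\big({}^{G(q)}q\big)\,G(q), & G(q)\neq 0,\\ 0,& G(q)=0,\end{cases}\qquad q\in X,$$ and $F^{\langle -1\rangle}$ denotes the two-sided inverse of $F$ with respect to $\diamond$ (whose unit is the constant function $1$), if it exists. Let $T$ be the identity function; for every $q_0\in\mathbb{H}$ the function $T-q_0$ has such an inverse on $\mathbb{H}\setminus O(q_0)$. A function $F\colon U\to\mathbb{H}$ on a region $U$ is skew differentiable at $q_0\in U$ if there is a function $E\colon U\to\mathbb{H}$, continuous at every point of $O(q_0)$, such that $F=F(q_0)+E\diamond(T-q_0)$ on $U$. It is skew regular on $U$ if it is skew differentiable at every point of $U$. The skew derivative of $F$ at $q_0$ is the limit $$F'(q_0)=\lim_{q\to q_0,\ q\notin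 O(q_0)}\Big((F-F(q_0))\diamond(T-q_0)^{\langle -1\rangle}\Big)(q).$$ Theorem. Let $F\colon U\to\mathbb{H}$ be skew regular on a region $U\subset\mathbb{H}$. Then $F$ is infinitely skew differentiable on $U$: with $F^{(0)}=F$ and $F^{(n+1)}=(F^{(n)})'$, for every $n\ge 0$ the function $F^{(n)}\colon U\to\mathbb{H}$ is defined, it is skew differentiable at every point of $U$, and the limit defining $(F^{(n)})'(q)$ exists at every $q\in U$. In particular, the skew derivative $F'\colon U\to\mathbb{H}$ is skew regular on $U$. -/

import Mathlib

open Filter Topology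
open scoped Quaternion

namespace SkewAnalysis

/-- The orbit `O(q)` of a quaternion under the action `ᵃq = a q a⁻¹` of the nonzero quaternions. -/
def orbit (q : ℍ[ℝ]) : Set ℍ[ℝ] := {p | ∃ a : ℍ[ℝ], a ≠ 0 ∧ p = a * q * a⁻¹}

/-- A set of quaternions that is invariant under conjugation by all nonzero quaternions. -/
def IsInvariant (X : Set ℍ[ℝ]) : Prop := ∀ a : ℍ[ℝ], a ≠ 0 → ∀ q ∈ X, a * q * a⁻¹ ∈ X

/-- A region: an open invariant set of quaternions. -/
def IsRegion (U : Set ℍ[ℝ]) : Prop := IsOpen U ∧ IsInvariant U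

open Classical in
/-- The (left) skew product `F ◇ G`. A function on an invariant set `X` is represented by a total
function, of which only the values on `X` matter: for `q ∈ X` the value `(F ◇ G) q` involves
only values of `F` and `G` at points of `X`. -/
noncomputable def skewProduct (F G : ℍ[ℝ] → ℍ[ℝ]) (q : ℍ[ℝ]) : ℍ[ℝ] :=
  if G q = 0 then 0 else F (G q * q * (G q)⁻¹) * G q

/-- `G` is a two-sided inverse of `F` for the skew product of functions on the invariant
set `X`. -/
def IsSkewInverseOn (X : Set ℍ[ℝ]) (F G : ℍ[ℝ] → ℍ[ℝ]) : Prop :=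
  ∀ q ∈ X, skewProduct F G q = 1 ∧ skewProduct G F q = 1

open Classical in
/-- The skew inverse of `F` on the invariant set `X`; its values on `X` are determined if `F` is
skew invertible on `X`, and it is `0` by convention otherwise. -/
noncomputable def skewInverse (X : Set ℍ[ℝ]) (F : ℍ[ℝ] → ℍ[ℝ]) : ℍ[ℝ] → ℍ[ℝ] :=
  if h : ∃ G, IsSkewInverseOn X F G then h.choose else 0

/-- `T - q₀`, where `T` is the identity function. -/
def idSub (q₀ : ℍ[ℝ]) : ℍ[ℝ] → ℍ[ℝ] := fun q => q - q₀

/-- `T - q₀` is skew invertible on the complement of the orbit of `q₀`, so that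
`skewInverse (orbit q₀)ᶜ (idSub q₀)` is its actual skew inverse. -/
theorem isSkewInverseOn_idSub (q₀ : ℍ[ℝ]) :
    IsSkewInverseOn (orbit q₀)ᶜ (idSub q₀) (skewInverse (orbit q₀)ᶜ (idSub q₀)) := by
  have key : ∀ q ∉ orbit q₀, ∀ y : ℍ[ℝ], y * q - q₀ * y = 0 → y = 0 := by
    intro q hq y hy
    by_contra hne
    refine hq ⟨y⁻¹, inv_ne_zero hne, ?_⟩
    rw [inv_inv, mul_assoc, ← sub_eq_zero.mp hy, ← mul_assoc, inv_mul_cancel₀ hne, one_mul]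
  have ex : ∀ q, ∃ y : ℍ[ℝ], q ∉ orbit q₀ → y * q - q₀ * y = 1 := by
    intro q
    by_cases hq : q ∈ orbit q₀
    · exact ⟨0, fun h => absurd hq h⟩
    let L : ℍ[ℝ] →ₗ[ℝ] ℍ[ℝ] := LinearMap.mulRight ℝ q - LinearMap.mulLeft ℝ q₀
    have hL : Function.Injective L := by
      rw [injective_iff_map_eq_zero]
      intro y hy
      exact key q hq y (by simpa [L] using hy)
    obtain ⟨y, hy⟩ := LinearMap.injective_iff_surjective.mp hL 1
    exact ⟨y, fun _ => by simpa [L] using hy⟩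
  choose g hg using ex
  have h : ∃ G, IsSkewInverseOn (orbit q₀)ᶜ (idSub q₀) G := by
    refine ⟨g, fun q hq => ⟨?_, ?_⟩⟩
    · have h1 := hg q hq
      have h0 : g q ≠ 0 := by
        intro h0
        simp [h0] at h1
      rw [skewProduct, if_neg h0, idSub, sub_mul, mul_assoc, inv_mul_cancel₀ h0, mul_one, h1]
    · have hx : q - q₀ ≠ 0 := by
        intro h0
        exact hq ⟨1, one_ne_zero, by simpa using sub_eq_zero.mp h0⟩
      have hq' : (q - q₀) * q * (q - q₀)⁻¹ ∉ orbit q₀ := by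
        rintro ⟨a, ha, he⟩
        refine hq ⟨(q - q₀)⁻¹ * a, mul_ne_zero (inv_ne_zero hx) ha, ?_⟩
        have : (q - q₀)⁻¹ * ((q - q₀) * q * (q - q₀)⁻¹) * (q - q₀) = q := by
          rw [mul_assoc, mul_assoc, mul_assoc, inv_mul_cancel₀ hx, mul_one, ← mul_assoc,
            inv_mul_cancel₀ hx, one_mul]
        calc q = (q - q₀)⁻¹ * (a * q₀ * a⁻¹) * (q - q₀) := by rw [← he, this]
          _ = _ := by rw [mul_inv_rev, inv_inv]; simp only [mul_assoc]
      have hy := hg _ hq'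
      have hz : (q - q₀)⁻¹ * ((q - q₀) * q * (q - q₀)⁻¹) - q₀ * (q - q₀)⁻¹ = 1 := by
        rw [← mul_assoc, ← mul_assoc, inv_mul_cancel₀ hx, one_mul, ← sub_mul, mul_inv_cancel₀ hx]
      have he : g ((q - q₀) * q * (q - q₀)⁻¹) = (q - q₀)⁻¹ := by
        rw [← sub_eq_zero]
        refine key _ hq' _ ?_
        rw [sub_mul, mul_sub, sub_sub_sub_comm, hy, hz, sub_self]
      have hx' : idSub q₀ q ≠ 0 := hx
      rw [skewProduct, if_neg hx']
      simp only [idSub, he, inv_mul_cancel₀ hx]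
  rw [skewInverse, dif_pos h]
  exact h.choose_spec

/-- `F : U → ℍ` is skew differentiable at `q`: `F = F(q) + E ◇ (T - q)` on `U` for some function
`E` that is continuous at all points of the orbit of `q`. -/
def SkewDifferentiableAt (U : Set ℍ[ℝ]) (F : ℍ[ℝ] → ℍ[ℝ]) (q : ℍ[ℝ]) : Prop :=
  ∃ E : ℍ[ℝ] → ℍ[ℝ], (∀ p ∈ orbit q, ContinuousAt E p) ∧
    ∀ p ∈ U, F p = F q + skewProduct E (idSub q) p

/-- `F` is skew regular on `U`: it is skew differentiable at all points of `U`. -/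
def SkewRegularOn (U : Set ℍ[ℝ]) (F : ℍ[ℝ] → ℍ[ℝ]) : Prop :=
  ∀ q ∈ U, SkewDifferentiableAt U F q

/-- The function `(F - F(q₀)) ◇ (T - q₀)^⟨-1⟩`, considered off the orbit of `q₀`. -/
noncomputable def skewQuotient (F : ℍ[ℝ] → ℍ[ℝ]) (q₀ : ℍ[ℝ]) : ℍ[ℝ] → ℍ[ℝ] :=
  skewProduct (fun q => F q - F q₀) (skewInverse (orbit q₀)ᶜ (idSub q₀))

/-- The limit of the skew quotient of `F` at `q₀`, for `q → q₀` with `q ∉ O(q₀)`, exists and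
equals `d`. -/
def HasSkewDerivAt (F : ℍ[ℝ] → ℍ[ℝ]) (d q₀ : ℍ[ℝ]) : Prop :=
  Tendsto (skewQuotient F q₀) (𝓝[(orbit q₀)ᶜ] q₀) (𝓝 d)

/-- The skew derivative `F'`, as a function of the base point (arbitrary where the limit does not
exist). -/
noncomputable def skewDeriv (F : ℍ[ℝ] → ℍ[ℝ]) : ℍ[ℝ] → ℍ[ℝ] :=
  fun q₀ => limUnder (𝓝[(orbit q₀)ᶜ] q₀) (skewQuotient F q₀)

/-- The `n`-th iterated skew derivative `F^(n)`. -/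
noncomputable def iteratedSkewDeriv (n : ℕ) (F : ℍ[ℝ] → ℍ[ℝ]) : ℍ[ℝ] → ℍ[ℝ] :=
  skewDeriv^[n] F

/-- `F` is infinitely skew differentiable on `U`: for every `n`, the iterated skew derivative
`F^(n)` is skew differentiable at every point `q` of `U`, and `F^(n+1)(q)` is its skew derivative
there, as a genuine limit. -/
def InfinitelySkewDifferentiableOn (U : Set ℍ[ℝ]) (F : ℍ[ℝ] → ℍ[ℝ]) : Prop :=
  ∀ n : ℕ, ∀ q ∈ U, SkewDifferentiableAt U (iteratedSkewDeriv n F) q ∧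
    HasSkewDerivAt (iteratedSkewDeriv n F) (iteratedSkewDeriv (n + 1) F q) q

end SkewAnalysis

/-! A function is skew regular exactly when it obeys the representation formula on spheres and is
holomorphic on each slice `ℝ + ℝI`, for right multiplication by that slice. Evaluate `F = F(q₀) + E
◇ (T - q₀)`. On the sphere of `q₀` it makes `F` affine, which is the representation formula
(`SkewRegularOn.isSliceOn`). On the slice of `q₀` everything commutes, so `E` is the difference
quotient and `F'(q₀) = E(q₀)` is the slice derivative (`SkewRegularOn.hasSliceDerivAt`). Hence `F'`
is holomorphic on slices by complex analysis, and it inherits the representation formula through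
real difference quotients (`SkewRegularOn.isSliceOn_skewDeriv`). Conversely,
`skewDifferentiableAt_sliceHom` builds `E` by extending the difference quotient from one slice to
all. So `F'` is skew regular, and induction finishes. -/

namespace SkewAnalysis

/-! ### Imaginary units and slices -/

/-- The real algebra homomorphism `x + iy ↦ x + yI` from the complex numbers to the slice of the
imaginary unit `I`. -/
noncomputable def sliceHom (I : ℍ[ℝ]) (hI : I * I = -1) : ℂ →ₐ[ℝ] ℍ[ℝ] := Complex.liftAux I hI

theorem exists_coordinates (a b c d : ℝ) :
    ∃ q : ℍ[ℝ], q.re = a ∧ q.imI = b ∧ q.imJ = c ∧ q.imK = d :=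
  ⟨⟨a, b, c, d⟩, rfl, rfl, rfl, rfl⟩

section Slices

variable {I J : ℍ[ℝ]} (hI : I * I = -1) (hJ : J * J = -1)

theorem sliceHom_apply (z : ℂ) : sliceHom I hI z = (z.re : ℍ[ℝ]) + z.im • I :=
  Complex.liftAux_apply I hI z

theorem re_eq_zero_of_mul_self (hI : I * I = -1) : I.re = 0 := by
  have h0 := congrArg QuaternionAlgebra.re hI
  have h1 := congrArg QuaternionAlgebra.imI hI
  have h2 := congrArg QuaternionAlgebra.imJ hI
  have h3 := congrArg QuaternionAlgebra.imK hI
  simp at h0 h1 h2 h3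
  by_contra h
  have e1 : I.imI = 0 := by
    have : I.re * I.imI = 0 := by linarith
    exact (mul_eq_zero.mp this).resolve_left h
  have e2 : I.imJ = 0 := by
    have : I.re * I.imJ = 0 := by linarith
    exact (mul_eq_zero.mp this).resolve_left h
  have e3 : I.imK = 0 := by
    have : I.re * I.imK = 0 := by linarith
    exact (mul_eq_zero.mp this).resolve_left h
  rw [e1, e2, e3] at h0
  nlinarith [mul_self_nonneg I.re]

theorem norm_eq_one_of_mul_self (hI : I * I = -1) : ‖I‖ = 1 := by
  have h := congrArg norm hI
  rw [norm_mul, norm_neg, norm_one] at h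
  nlinarith [norm_nonneg I]

theorem sliceHom_re (z : ℂ) : (sliceHom I hI z).re = z.re := by
  simp [sliceHom_apply, re_eq_zero_of_mul_self hI]

theorem sliceHom_im (z : ℂ) : (sliceHom I hI z).im = z.im • I := by
  rw [sliceHom_apply]
  ext <;> simp [re_eq_zero_of_mul_self hI]

theorem sliceHom_mul_comm (z w : ℂ) :
    sliceHom I hI z * sliceHom I hI w = sliceHom I hI w * sliceHom I hI z := by
  rw [← map_mul, mul_comm, map_mul]

theorem sliceHom_conj (z : ℂ) :
    sliceHom I hI (starRingEnd ℂ z) = (z.re : ℍ[ℝ]) - z.im • I := by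
  simp [sliceHom_apply, sub_eq_add_neg]

theorem continuous_sliceHom : Continuous (sliceHom I hI) :=
  LinearMap.continuous_of_finiteDimensional (sliceHom I hI).toLinearMap

theorem norm_sliceHom (z : ℂ) : ‖sliceHom I hI z‖ = ‖z‖ := by
  have h1 := Quaternion.normSq_eq_norm_mul_self I
  rw [norm_eq_one_of_mul_self hI, Quaternion.normSq_def'] at h1
  have h2 := Quaternion.normSq_eq_norm_mul_self (sliceHom I hI z)
  rw [Quaternion.normSq_def', sliceHom_apply] at h2
  simp [re_eq_zero_of_mul_self hI] at h1 h2
  rw [← sliceHom_apply hI] at h2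
  have h3 := Complex.sq_norm z
  rw [Complex.normSq_apply] at h3
  rw [← sq_eq_sq₀ (norm_nonneg _) (norm_nonneg _)]
  linear_combination -h2 - h3 + z.im ^ 2 * h1

theorem sliceHom_ne_zero {z : ℂ} (hz : z ≠ 0) : sliceHom I hI z ≠ 0 := by
  rw [← norm_ne_zero_iff, norm_sliceHom, norm_ne_zero_iff]
  exact hz

theorem conj_mul_self (hI : I * I = -1) {a : ℍ[ℝ]} (ha : a ≠ 0) :
    a * I * a⁻¹ * (a * I * a⁻¹) = -1 := by
  calc a * I * a⁻¹ * (a * I * a⁻¹) = a * I * (a⁻¹ * a) * I * a⁻¹ := by simp only [mul_assoc]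
    _ = a * (I * I) * a⁻¹ := by rw [inv_mul_cancel₀ ha]; simp only [mul_assoc, mul_one]
    _ = -1 := by rw [hI]; simp [ha]

theorem conj_sliceHom {a : ℍ[ℝ]} (ha : a ≠ 0) (z : ℂ) :
    a * sliceHom I hI z * a⁻¹ = sliceHom (a * I * a⁻¹) (conj_mul_self hI ha) z := by
  rw [sliceHom_apply, sliceHom_apply, mul_add, add_mul, ← Quaternion.coe_commutes, mul_assoc,
    mul_inv_cancel₀ ha, mul_one, mul_smul_comm, smul_mul_assoc]

/-- Any two imaginary units are conjugate. -/
theorem exists_conj_eq (hI : I * I = -1) (hJ : J * J = -1) : ∃ a : ℍ[ℝ], a ≠ 0 ∧ J = a * I * a⁻¹ := by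
  suffices h : ∃ a : ℍ[ℝ], a ≠ 0 ∧ J * a = a * I by
    obtain ⟨a, ha, h⟩ := h
    exact ⟨a, ha, by rw [← h, mul_assoc, mul_inv_cancel₀ ha, mul_one]⟩
  by_cases hIJ : I + J = 0
  · have hJI : J = -I := eq_neg_of_add_eq_zero_right hIJ
    -- `I` is not central, and every commutator `cI - Ic` anticommutes with `I`, so a nonzero one
    -- conjugates `I` to `-I`.
    have hc : ∃ c : ℍ[ℝ], c * I - I * c ≠ 0 := by
      by_contra! hc
      obtain ⟨i, i0, i1, i2, i3⟩ := exists_coordinates 0 1 0 0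
      obtain ⟨j, j0, j1, j2, j3⟩ := exists_coordinates 0 0 1 0
      have h1 := hc i
      have h2 := hc j
      have a1 := congrArg QuaternionAlgebra.imJ h1
      have a2 := congrArg QuaternionAlgebra.imK h1
      have a3 := congrArg QuaternionAlgebra.imK h2
      simp [i0, i1, i2, i3, j0, j1, j2, j3] at a1 a2 a3
      have h0 : I = 0 := by
        ext
        · simpa using re_eq_zero_of_mul_self hI
        · simp; linarith
        · simp; linarith
        · simp; linarith
      simp [h0] at hI
    obtain ⟨c, hc⟩ := hc
    refine ⟨_, hc, ?_⟩
    rw [hJI, mul_sub, sub_mul, neg_mul, neg_mul, ← mul_assoc I I c, mul_assoc c I I, hI]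
    simp [mul_assoc]
    abel
  -- The witness is `I + J`: both `J(I + J)` and `(I + J)I` equal `JI - 1`.
  · exact ⟨_, hIJ, by rw [mul_add, add_mul, hI, hJ, add_comm]⟩

theorem sliceHom_mem {U : Set ℍ[ℝ]} (hU : IsInvariant U) {z : ℂ} (hz : sliceHom I hI z ∈ U) :
    sliceHom J hJ z ∈ U := by
  obtain ⟨a, ha, rfl⟩ := exists_conj_eq hI hJ
  rw [← conj_sliceHom hI ha]
  exact hU a ha _ hz

theorem sliceHom_neg (z : ℂ) :
    sliceHom (-I) (by rw [neg_mul_neg, hI]) z = sliceHom I hI (starRingEnd ℂ z) := by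
  rw [sliceHom_conj, sliceHom_apply, smul_neg, sub_eq_add_neg]

theorem sliceHom_conj_mem {U : Set ℍ[ℝ]} (hU : IsInvariant U) {z : ℂ} (hz : sliceHom I hI z ∈ U) :
    sliceHom I hI (starRingEnd ℂ z) ∈ U := by
  rw [← sliceHom_neg hI]
  exact sliceHom_mem hI _ hU hz

theorem eq_sliceHom_of_mem_orbit {z : ℂ} {p : ℍ[ℝ]} (hp : p ∈ orbit (sliceHom I hI z)) :
    ∃ (K : ℍ[ℝ]) (hK : K * K = -1), p = sliceHom K hK z := by
  obtain ⟨a, ha, rfl⟩ := hp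
  exact ⟨_, _, conj_sliceHom hI ha z⟩

/-- Conjugation by `p - q` sends `p` to the conjugate of `q`, for `p` and `q` on one sphere. -/
theorem sub_mul_sliceHom (z : ℂ) :
    (sliceHom J hJ z - sliceHom I hI z) * sliceHom J hJ z =
      sliceHom I hI (starRingEnd ℂ z) * (sliceHom J hJ z - sliceHom I hI z) := by
  rw [sliceHom_conj, sliceHom_apply, sliceHom_apply]
  simp only [mul_add, add_mul, sub_mul, mul_sub, smul_mul_assoc, mul_smul_comm, hI, hJ,
    Quaternion.coe_commutes]
  module

end Slices

/-! ### Slice coordinates and the representation formula -/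

/-- The real part and the length of the imaginary part, as a point of the upper half plane. -/
noncomputable def sliceCoord (q : ℍ[ℝ]) : ℂ := ⟨q.re, ‖q.im‖⟩

theorem continuous_sliceCoord : Continuous sliceCoord :=
  Complex.equivRealProdCLM.symm.continuous.comp
    (Quaternion.continuous_re.prodMk Quaternion.continuous_im.norm)

theorem exists_eq_sliceHom (q : ℍ[ℝ]) :
    ∃ (I : ℍ[ℝ]) (hI : I * I = -1), q = sliceHom I hI (sliceCoord q) := by
  by_cases h : q.im = 0
  · obtain ⟨i, i0, i1, i2, i3⟩ := exists_coordinates 0 1 0 0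
    refine ⟨i, by ext <;> simp [i0, i1, i2, i3], ?_⟩
    rw [sliceHom_apply, sliceCoord, h]
    simpa [h] using (Quaternion.re_add_im q).symm
  · have hn : ‖q.im‖ ≠ 0 := norm_ne_zero_iff.mpr h
    refine ⟨‖q.im‖⁻¹ • q.im, ?_, ?_⟩
    · have h1 := Quaternion.im_sq q
      rw [Quaternion.normSq_eq_norm_mul_self, pow_two] at h1
      rw [smul_mul_smul_comm, h1, ← Quaternion.coe_neg, ← Quaternion.coe_mul_eq_smul,
        ← Quaternion.coe_mul, ← Quaternion.coe_one, ← Quaternion.coe_neg]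
      congr 1
      field_simp
    · rw [sliceHom_apply, sliceCoord, smul_smul, mul_inv_cancel₀ hn, one_smul]
      exact (Quaternion.re_add_im q).symm

theorem sliceCoord_sliceHom {I : ℍ[ℝ]} (hI : I * I = -1) (z : ℂ) :
    sliceCoord (sliceHom I hI z) = ⟨z.re, |z.im|⟩ := by
  rw [sliceCoord, sliceHom_re, sliceHom_im, norm_smul, norm_eq_one_of_mul_self hI, mul_one,
    Real.norm_eq_abs]

/-- The value at `x + yJ` of the slice function with values `P` at `x + yI` and `M` at `x - yI`. -/
noncomputable def sliceExt (I J P M : ℍ[ℝ]) : ℍ[ℝ] :=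
  (1 / 2 : ℝ) • (P + M) + (1 / 2 : ℝ) • (M - P) * I * J

theorem sliceExt_eq {I J : ℍ[ℝ]} (hI : I * I = -1) (X Y : ℍ[ℝ]) :
    sliceExt I J (X + Y * I) (X - Y * I) = X + Y * J := by
  have h1 : (1 / 2 : ℝ) • (X + Y * I + (X - Y * I)) = X := by module
  have h2 : (1 / 2 : ℝ) • (X - Y * I - (X + Y * I)) = -(Y * I) := by module
  rw [sliceExt, h1, h2, neg_mul, mul_assoc Y, hI, mul_neg_one, neg_neg]

/-- `F` satisfies the representation formula on `U`: its values on a sphere are determined by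
those at two opposite points. -/
def IsSliceOn (U : Set ℍ[ℝ]) (F : ℍ[ℝ] → ℍ[ℝ]) : Prop :=
  ∀ (I J : ℍ[ℝ]) (hI : I * I = -1) (hJ : J * J = -1) (z : ℂ), sliceHom J hJ z ∈ U →
    F (sliceHom J hJ z) = sliceExt I J (F (sliceHom I hI z)) (F (sliceHom I hI (starRingEnd ℂ z)))

/-- `f : ℂ → ℍ` has derivative `d` at `z` for the right complex structure given by `I`. -/
def HasSliceDerivAt (I : ℍ[ℝ]) (hI : I * I = -1) (f : ℂ → ℍ[ℝ]) (d : ℍ[ℝ]) (z : ℂ) : Prop :=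
  Tendsto (fun w => (f w - f z) * (sliceHom I hI (w - z))⁻¹) (𝓝[≠] z) (𝓝 d)

/-- The complex normed space structure on the quaternions by right multiplication with elements
of the slice of `I`. -/
noncomputable abbrev sliceNormedSpace (I : ℍ[ℝ]) (hI : I * I = -1) : NormedSpace ℂ ℍ[ℝ] where
  smul z q := q * sliceHom I hI z
  one_smul q := by change q * sliceHom I hI 1 = q; rw [map_one, mul_one]
  mul_smul z w q := by
    change q * sliceHom I hI (z * w) = q * sliceHom I hI w * sliceHom I hI z
    rw [mul_comm z w, map_mul, mul_assoc]
  smul_zero z := zero_mul _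
  smul_add z p q := add_mul _ _ _
  add_smul z w q := by
    change q * sliceHom I hI (z + w) = q * sliceHom I hI z + q * sliceHom I hI w
    rw [map_add, mul_add]
  zero_smul q := by change q * sliceHom I hI 0 = 0; rw [map_zero, mul_zero]
  norm_smul_le z q := by
    change ‖q * sliceHom I hI z‖ ≤ _
    rw [norm_mul, norm_sliceHom, mul_comm]

theorem HasSliceDerivAt.continuousAt {I : ℍ[ℝ]} {hI : I * I = -1} {f : ℂ → ℍ[ℝ]} {d : ℍ[ℝ]} {z : ℂ}
    (h : HasSliceDerivAt I hI f d z) : ContinuousAt f z := by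
  have h1 : Tendsto (fun w => sliceHom I hI (w - z)) (𝓝[≠] z) (𝓝 0) := by
    have : ContinuousAt (fun w => sliceHom I hI (w - z)) z :=
      ((continuous_sliceHom hI).comp (continuous_id.sub continuous_const)).continuousAt
    have h2 := this.tendsto
    rw [sub_self, map_zero] at h2
    exact h2.mono_left nhdsWithin_le_nhds
  have h2 := (h.mul h1).add_const (f z)
  rw [mul_zero, zero_add] at h2
  rw [← continuousWithinAt_compl_self]
  refine h2.congr' ?_
  filter_upwards [self_mem_nhdsWithin] with w hw
  rw [mul_assoc, inv_mul_cancel₀ (sliceHom_ne_zero hI (sub_ne_zero.mpr hw)), mul_one,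
    sub_add_cancel]

/-- The derivative of a holomorphic function on an open subset of a slice is holomorphic. -/
theorem exists_hasSliceDerivAt_deriv {I : ℍ[ℝ]} {hI : I * I = -1} {f d : ℂ → ℍ[ℝ]} {D : Set ℂ}
    (hD : IsOpen D) (h : ∀ z ∈ D, HasSliceDerivAt I hI f (d z) z) {z : ℂ} (hz : z ∈ D) :
    ∃ d', HasSliceDerivAt I hI d d' z := by
  let _ := sliceNormedSpace I hI
  -- For scalars acting by right multiplication, slice differentiability is ordinary complex
  -- differentiability into a Banach space.
  have key : ∀ (g : ℂ → ℍ[ℝ]) (g' : ℍ[ℝ]) (w : ℂ), HasDerivAt g g' w ↔ HasSliceDerivAt I hI g g' w := by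
    intro g g' w
    rw [hasDerivAt_iff_tendsto_slope, HasSliceDerivAt]
    refine tendsto_congr fun v => ?_
    change (g v - g w) * sliceHom I hI (v - w)⁻¹ = _
    rw [map_inv₀]
  have hf : DifferentiableOn ℂ f D := fun w hw =>
    ((key f (d w) w).mpr (h w hw)).differentiableAt.differentiableWithinAt
  have hf' := (hf.deriv hD).differentiableAt (hD.mem_nhds hz)
  have he : deriv f =ᶠ[𝓝 z] d := by
    filter_upwards [hD.mem_nhds hz] with w hw
    exact ((key f (d w) w).mpr (h w hw)).deriv
  exact ⟨_, (key d _ z).mp (hf'.hasDerivAt.congr_of_eventuallyEq he.symm)⟩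

/-! ### From skew regularity to holomorphic slice functions -/

section SkewRegular

variable {U : Set ℍ[ℝ]} {F : ℍ[ℝ] → ℍ[ℝ]} {E : ℍ[ℝ] → ℍ[ℝ]}

/-- A skew differentiable function is left affine on the sphere through the base point. -/
theorem eq_add_mul_sub_of_skewProduct {I J : ℍ[ℝ]} (hI : I * I = -1) (hJ : J * J = -1) {z : ℂ}
    (hE : ∀ p ∈ U, F p = F (sliceHom I hI z) + skewProduct E (idSub (sliceHom I hI z)) p)
    (hz : sliceHom J hJ z ∈ U) :
    F (sliceHom J hJ z) = F (sliceHom I hI z) +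
      E (sliceHom I hI (starRingEnd ℂ z)) * (sliceHom J hJ z - sliceHom I hI z) := by
  rw [hE _ hz, skewProduct, idSub]
  split_ifs with h
  · rw [h, mul_zero]
  · rw [sub_mul_sliceHom, mul_assoc _ _ (_)⁻¹, mul_inv_cancel₀ h, mul_one]

/-- An affine map `p ↦ A + B(p - q₀)` on a sphere is determined by its values at two opposite
points. -/
theorem SkewRegularOn.isSliceOn (hU : IsInvariant U) (hF : SkewRegularOn U F) : IsSliceOn U F := by
  intro I J hI hJ z hz
  have hzI := sliceHom_mem hJ hI hU hz
  obtain ⟨E, -, hE⟩ := hF _ hzI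
  have h1 := eq_add_mul_sub_of_skewProduct hI hJ hE hz
  have h2 := eq_add_mul_sub_of_skewProduct hI (by rw [neg_mul_neg, hI]) hE
    (sliceHom_mem (J := -I) hI _ hU hzI)
  rw [sliceHom_neg hI] at h2
  rw [h1, h2]
  generalize E (sliceHom I hI (starRingEnd ℂ z)) = B
  generalize F (sliceHom I hI z) = A
  -- The values at the two opposite points are `X ± Y I` with `X = A - yBI` and `Y = yB`, where `y =
  -- z.im`.
  have e1 : A = (A - z.im • B * I) + z.im • B * I := by abel
  have e2 : A + B * (sliceHom I hI (starRingEnd ℂ z) - sliceHom I hI z) =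
      (A - z.im • B * I) - z.im • B * I := by
    rw [sliceHom_conj, sliceHom_apply]
    simp only [mul_sub, mul_add, mul_smul_comm, smul_mul_assoc]
    abel
  rw [e2]
  conv_rhs => rw [e1]
  rw [add_sub_assoc, sub_self, add_zero, sliceExt_eq hI, sliceHom_apply, sliceHom_apply]
  simp only [mul_sub, mul_add, mul_smul_comm, smul_mul_assoc]
  abel

theorem isOpen_preimage_sliceHom (hU : IsOpen U) {I : ℍ[ℝ]} (hI : I * I = -1) :
    IsOpen (sliceHom I hI ⁻¹' U) :=
  hU.preimage (continuous_sliceHom hI)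

/-- Points of one slice commute, so there the conjugation in `E ◇ (T - q₀)` is trivial and the
product is pointwise. -/
theorem hasSliceDerivAt_of_skewProduct (hU : IsOpen U) {I : ℍ[ℝ]} (hI : I * I = -1) {z : ℂ}
    (hz : sliceHom I hI z ∈ U) (hc : ContinuousAt E (sliceHom I hI z))
    (hE : ∀ p ∈ U, F p = F (sliceHom I hI z) + skewProduct E (idSub (sliceHom I hI z)) p) :
    HasSliceDerivAt I hI (fun w => F (sliceHom I hI w)) (E (sliceHom I hI z)) z := by
  have hc' : Tendsto (fun w => E (sliceHom I hI w)) (𝓝[≠] z) (𝓝 (E (sliceHom I hI z))) :=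
    (hc.tendsto.comp (continuous_sliceHom hI).continuousAt).mono_left nhdsWithin_le_nhds
  refine hc'.congr' ?_
  filter_upwards [self_mem_nhdsWithin,
    nhdsWithin_le_nhds ((isOpen_preimage_sliceHom hU hI).mem_nhds hz)] with w hw hwU
  have h0 := sliceHom_ne_zero hI (sub_ne_zero.mpr hw)
  have h1 : idSub (sliceHom I hI z) (sliceHom I hI w) = sliceHom I hI (w - z) := by
    rw [idSub, map_sub]
  rw [hE _ hwU, add_sub_cancel_left, skewProduct, h1, if_neg h0, sliceHom_mul_comm,
    mul_assoc _ _ (_)⁻¹, mul_inv_cancel₀ h0, mul_one, mul_assoc, mul_inv_cancel₀ h0, mul_one]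

/-- Off the orbit of the base point, the skew quotient of `F` is the function `E` in the
definition of skew differentiability. -/
theorem skewQuotient_eq (hU : IsInvariant U) {q₀ q : ℍ[ℝ]}
    (hE : ∀ p ∈ U, F p = F q₀ + skewProduct E (idSub q₀) p) (hq : q ∈ U) (hq₀ : q ∉ orbit q₀) :
    skewQuotient F q₀ q = E q := by
  have h := (isSkewInverseOn_idSub q₀ q hq₀).1
  rw [skewQuotient, skewProduct]
  rw [skewProduct] at h
  generalize skewInverse (orbit q₀)ᶜ (idSub q₀) q = g at h ⊢
  split_ifs at h with hg
  · simp at h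
  -- At `gqg⁻¹` the value of `T - q₀` is `g⁻¹`, so the second conjugation undoes the first and `E`
  -- is evaluated at `q`.
  have hs : g * q * g⁻¹ - q₀ = g⁻¹ := eq_inv_of_mul_eq_one_left h
  have hs' : idSub q₀ (g * q * g⁻¹) = g⁻¹ := hs
  have hc : g⁻¹ * (g * q * g⁻¹) * g = q := by
    calc g⁻¹ * (g * q * g⁻¹) * g = (g⁻¹ * g) * q * (g⁻¹ * g) := by simp only [mul_assoc]
      _ = q := by rw [inv_mul_cancel₀ hg, one_mul, mul_one]
  rw [if_neg hg, hE _ (hU g hg q hq), add_sub_cancel_left, skewProduct, hs',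
    if_neg (inv_ne_zero hg), inv_inv, hc, mul_assoc, inv_mul_cancel₀ hg, mul_one]

theorem re_conj (q : ℍ[ℝ]) {a : ℍ[ℝ]} (ha : a ≠ 0) : (a * q * a⁻¹).re = q.re := by
  obtain ⟨I, hI, hq⟩ := exists_eq_sliceHom q
  rw [hq, conj_sliceHom hI ha, sliceHom_re, sliceHom_re]

/-- Conjugation preserves the real part, so real translates of `q` leave its orbit. This makes the
skew derivative unique. -/
theorem neBot_nhdsWithin_compl_orbit (q : ℍ[ℝ]) : (𝓝[(orbit q)ᶜ] q).NeBot := by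
  have h : Tendsto (fun t : ℝ => q + (t : ℍ[ℝ])) (𝓝[≠] 0) (𝓝[(orbit q)ᶜ] q) := by
    refine tendsto_nhdsWithin_iff.mpr ⟨?_, ?_⟩
    · have hc : Continuous fun t : ℝ => q + (t : ℍ[ℝ]) :=
        continuous_const.add Quaternion.continuous_coe
      have := hc.tendsto 0
      rw [Quaternion.coe_zero, add_zero] at this
      exact this.mono_left nhdsWithin_le_nhds
    · filter_upwards [self_mem_nhdsWithin] with t ht
      rintro ⟨a, ha, he⟩
      have := congrArg QuaternionAlgebra.re he
      rw [re_conj q ha] at this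
      exact ht (by simpa using this)
  exact h.neBot

theorem mem_orbit_self (q : ℍ[ℝ]) : q ∈ orbit q := ⟨1, one_ne_zero, by simp⟩

theorem hasSkewDerivAt_of_skewProduct (hU : IsRegion U) {q₀ : ℍ[ℝ]} (hq₀ : q₀ ∈ U)
    (hc : ContinuousAt E q₀) (hE : ∀ p ∈ U, F p = F q₀ + skewProduct E (idSub q₀) p) :
    HasSkewDerivAt F (E q₀) q₀ := by
  refine (hc.tendsto.mono_left nhdsWithin_le_nhds).congr' ?_
  filter_upwards [self_mem_nhdsWithin, nhdsWithin_le_nhds (hU.1.mem_nhds hq₀)] with q h1 h2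
  exact (skewQuotient_eq hU.2 hE h2 h1).symm

theorem HasSkewDerivAt.skewDeriv_eq {d q₀ : ℍ[ℝ]} (h : HasSkewDerivAt F d q₀) :
    skewDeriv F q₀ = d :=
  haveI := neBot_nhdsWithin_compl_orbit q₀
  h.limUnder_eq

theorem SkewRegularOn.hasSkewDerivAt (hU : IsRegion U) (hF : SkewRegularOn U F) {q : ℍ[ℝ]}
    (hq : q ∈ U) : HasSkewDerivAt F (skewDeriv F q) q := by
  obtain ⟨E, hc, hE⟩ := hF q hq
  have h := hasSkewDerivAt_of_skewProduct hU hq (hc q (mem_orbit_self q)) hE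
  rwa [h.skewDeriv_eq]

theorem SkewRegularOn.hasSliceDerivAt (hU : IsRegion U) (hF : SkewRegularOn U F) {I : ℍ[ℝ]}
    (hI : I * I = -1) {z : ℂ} (hz : sliceHom I hI z ∈ U) :
    HasSliceDerivAt I hI (fun w => F (sliceHom I hI w)) (skewDeriv F (sliceHom I hI z)) z := by
  obtain ⟨E, hc, hE⟩ := hF _ hz
  have hc' := hc _ (mem_orbit_self _)
  rw [(hasSkewDerivAt_of_skewProduct hU hz hc' hE).skewDeriv_eq]
  exact hasSliceDerivAt_of_skewProduct hU.1 hI hz hc' hE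

/-- Real increments lie in every slice, which allows derivatives on different slices to be compared.
-/
theorem HasSliceDerivAt.tendsto_real {I : ℍ[ℝ]} {hI : I * I = -1} {f : ℂ → ℍ[ℝ]} {d : ℍ[ℝ]} {z : ℂ}
    (h : HasSliceDerivAt I hI f d z) :
    Tendsto (fun t : ℝ => t⁻¹ • (f (z + t) - f z)) (𝓝[≠] 0) (𝓝 d) := by
  have h1 : Tendsto (fun t : ℝ => z + (t : ℂ)) (𝓝[≠] 0) (𝓝[≠] z) := by
    refine tendsto_nhdsWithin_iff.mpr ⟨?_, ?_⟩
    · have hc : Continuous fun t : ℝ => z + (t : ℂ) :=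
        continuous_const.add Complex.continuous_ofReal
      have := hc.tendsto 0
      rw [Complex.ofReal_zero, add_zero] at this
      exact this.mono_left nhdsWithin_le_nhds
    · filter_upwards [self_mem_nhdsWithin] with t ht
      simpa using ht
  refine (h.comp h1).congr fun t => ?_
  have h2 : sliceHom I hI (z + t - z) = (t : ℍ[ℝ]) := by
    rw [add_sub_cancel_left, sliceHom_apply]
    simp
  rw [Function.comp_apply, h2, ← Quaternion.coe_inv, Quaternion.mul_coe_eq_smul]

/-- The representation formula is real linear and conjugation fixes real increments, so it holds for
real difference quotients and passes to the limit. -/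
theorem SkewRegularOn.isSliceOn_skewDeriv (hU : IsRegion U) (hF : SkewRegularOn U F) :
    IsSliceOn U (skewDeriv F) := by
  intro I J hI hJ z hz
  have hzI := sliceHom_mem hJ hI hU.2 hz
  have hzc := sliceHom_conj_mem hI hU.2 hzI
  have h1 := (hF.hasSliceDerivAt hU hJ hz).tendsto_real
  have h2 := (hF.hasSliceDerivAt hU hI hzI).tendsto_real
  have h3 := (hF.hasSliceDerivAt hU hI hzc).tendsto_real
  refine tendsto_nhds_unique h1 ?_
  have h4 := ((h2.add h3).const_smul (1 / 2 : ℝ)).add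
    ((((h3.sub h2).const_smul (1 / 2 : ℝ)).mul_const I).mul_const J)
  refine h4.congr' ?_
  have h5 : Tendsto (fun t : ℝ => z + (t : ℂ)) (𝓝[≠] 0) (𝓝 z) := by
    have hc : Continuous fun t : ℝ => z + (t : ℂ) :=
      continuous_const.add Complex.continuous_ofReal
    have := hc.tendsto 0
    rw [Complex.ofReal_zero, add_zero] at this
    exact this.mono_left nhdsWithin_le_nhds
  filter_upwards [h5 ((isOpen_preimage_sliceHom hU.1 hJ).mem_nhds hz)] with t ht
  have hs := hF.isSliceOn hU.2
  rw [hs I J hI hJ z hz, hs I J hI hJ (z + t) ht, map_add (starRingEnd ℂ), Complex.conj_ofReal]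
  simp only [sliceExt, sub_mul, smul_mul_assoc, smul_sub, smul_add]
  module

end SkewRegular

/-! ### From holomorphic slice functions back to skew differentiability -/

/-- A slice function that is holomorphic on slices is skew differentiable. -/
theorem skewDifferentiableAt_sliceHom {U : Set ℍ[ℝ]} {G : ℍ[ℝ] → ℍ[ℝ]} (hs : IsSliceOn U G)
    {I : ℍ[ℝ]} {hI : I * I = -1} {z₀ : ℂ} (h0 : 0 ≤ z₀.im) {d : ℍ[ℝ]}
    (hd : HasSliceDerivAt I hI (fun w => G (sliceHom I hI w)) d z₀)
    (hc : ContinuousAt (fun w => G (sliceHom I hI w)) (starRingEnd ℂ z₀)) :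
    SkewDifferentiableAt U G (sliceHom I hI z₀) := by
  let e : ℂ → ℍ[ℝ] := Function.update
    (fun w => (G (sliceHom I hI w) - G (sliceHom I hI z₀)) * (sliceHom I hI (w - z₀))⁻¹) z₀ d
  have he : ∀ w, G (sliceHom I hI w) = G (sliceHom I hI z₀) + e w * sliceHom I hI (w - z₀) := by
    intro w
    by_cases hw : w = z₀
    · rw [hw, sub_self, map_zero, mul_zero, add_zero]
    · simp only [e, Function.update_of_ne hw]
      rw [mul_assoc, inv_mul_cancel₀ (sliceHom_ne_zero hI (sub_ne_zero.mpr hw)), mul_one,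
        add_sub_cancel]
  have he0 : ContinuousAt e z₀ := continuousAt_update_same.mpr hd
  have he1 : ContinuousAt e (starRingEnd ℂ z₀) := by
    by_cases hz : starRingEnd ℂ z₀ = z₀
    · rwa [hz]
    · refine (continuousAt_update_of_ne hz).mpr ((hc.sub continuousAt_const).mul ?_)
      refine ContinuousAt.inv₀ ?_ (sliceHom_ne_zero hI (sub_ne_zero.mpr hz))
      exact ((continuous_sliceHom hI).comp (continuous_id.sub continuous_const)).continuousAt
  have hec : ContinuousAt (fun z => e (starRingEnd ℂ z)) z₀ :=
    ContinuousAt.comp (g := e) he1 Complex.continuous_conj.continuousAt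
  -- Split `e = a + bI` with `a` even and `b` odd under conjugation; then `a + bJ` is well defined
  -- at `x + yJ`, whichever sign of `J` is used.
  let a : ℂ → ℍ[ℝ] := fun z => (1 / 2 : ℝ) • (e z + e (starRingEnd ℂ z))
  let b : ℂ → ℍ[ℝ] := fun z => (1 / 2 : ℝ) • (e (starRingEnd ℂ z) - e z) * I
  have ha : ContinuousAt a z₀ := (he0.add hec).const_smul (1 / 2 : ℝ)
  have hb : ContinuousAt b z₀ := ((hec.sub he0).const_smul (1 / 2 : ℝ)).mul continuousAt_const
  have ha_conj : ∀ z, a (starRingEnd ℂ z) = a z := fun z => by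
    simp only [a, Complex.conj_conj, add_comm]
  have hb_conj : ∀ z, b (starRingEnd ℂ z) = -b z := fun z => by
    simp only [b, Complex.conj_conj, ← neg_mul, ← smul_neg, neg_sub]
  have hea : ∀ z, e z = a z + b z * I := fun z => by
    simp only [a, b]
    rw [mul_assoc, hI, mul_neg_one]
    module
  have hb_real : ∀ z : ℂ, z.im = 0 → b z = 0 := fun z hz => by
    have : starRingEnd ℂ z = z := Complex.conj_eq_iff_im.mpr hz
    simp [b, this]
  -- At real `q` the inverse of `0` is `0`, leaving `a` alone, as it should since `b` vanishes
  -- there.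
  let E : ℍ[ℝ] → ℍ[ℝ] := fun q => a (sliceCoord q) + b (sliceCoord q) * (‖q.im‖⁻¹ • q.im)
  have hE : ∀ (J : ℍ[ℝ]) (hJ : J * J = -1) (z : ℂ), E (sliceHom J hJ z) = a z + b z * J := by
    intro J hJ z
    simp only [E]
    rw [sliceCoord_sliceHom, sliceHom_im, norm_smul, norm_eq_one_of_mul_self hJ, mul_one,
      Real.norm_eq_abs, smul_smul]
    rcases lt_trichotomy z.im 0 with hz | hz | hz
    · have h1 : (⟨z.re, |z.im|⟩ : ℂ) = starRingEnd ℂ z :=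
        Complex.ext rfl (by simp [abs_of_neg hz])
      rw [h1, ha_conj, hb_conj, abs_of_neg hz, inv_neg, neg_mul (z.im⁻¹),
        inv_mul_cancel₀ hz.ne, neg_smul, one_smul, neg_mul_neg]
    · have h1 : (⟨z.re, |z.im|⟩ : ℂ) = z := Complex.ext rfl (by simp [hz])
      rw [h1, hb_real z hz, zero_mul, zero_mul]
    · have h1 : (⟨z.re, |z.im|⟩ : ℂ) = z := Complex.ext rfl (by simp [abs_of_pos hz])
      rw [h1, abs_of_pos hz, inv_mul_cancel₀ hz.ne', one_smul]
  refine ⟨E, ?_, ?_⟩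
  · intro p hp
    obtain ⟨J, hJ, rfl⟩ := eq_sliceHom_of_mem_orbit hI hp
    have hz : sliceCoord (sliceHom J hJ z₀) = z₀ := by
      rw [sliceCoord_sliceHom, abs_of_nonneg h0]
    have ha' : ContinuousAt (fun q => a (sliceCoord q)) (sliceHom J hJ z₀) :=
      ContinuousAt.comp (g := a) (by rwa [hz]) continuous_sliceCoord.continuousAt
    have hb' : ContinuousAt (fun q => b (sliceCoord q)) (sliceHom J hJ z₀) :=
      ContinuousAt.comp (g := b) (by rwa [hz]) continuous_sliceCoord.continuousAt
    refine ha'.add ?_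
    -- At a real point the direction of `q.im` has no limit, but it is bounded by `1` and multiplied
    -- by `b → 0`.
    rcases h0.eq_or_lt with h | h
    · have hb0 : b (sliceCoord (sliceHom J hJ z₀)) = 0 := by rw [hz, hb_real _ h.symm]
      have hb1 := hb'.tendsto.norm
      rw [ContinuousAt, hb0, zero_mul]
      rw [hb0, norm_zero] at hb1
      refine squeeze_zero_norm (fun q => ?_) hb1
      rw [norm_mul, norm_smul, norm_inv, norm_norm]
      exact mul_le_of_le_one_right (norm_nonneg _) inv_mul_le_one
    · refine hb'.mul (ContinuousAt.fun_smul (ContinuousAt.fun_inv₀ ?_ ?_) ?_)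
      · exact Quaternion.continuous_im.norm.continuousAt
      · rw [sliceHom_im, norm_smul, norm_eq_one_of_mul_self hJ, mul_one, norm_ne_zero_iff]
        exact h.ne'
      · exact Quaternion.continuous_im.continuousAt
  · intro p hp
    obtain ⟨J, hJ, hpJ⟩ := exists_eq_sliceHom p
    generalize sliceCoord p = z at hpJ
    subst hpJ
    rw [skewProduct]
    split_ifs with hw
    · rw [add_zero, sub_eq_zero.mp hw]
    -- With `w = p - q₀`, the skew product is `(a + b wJw⁻¹)w = aw + bwJ`.
    · rw [conj_sliceHom hJ hw, hE, add_mul, mul_assoc (b z), mul_assoc (_ * J),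
        inv_mul_cancel₀ hw, mul_one, hs I J hI hJ z hp, he z, he (starRingEnd ℂ z),
        hea (starRingEnd ℂ z), ha_conj, hb_conj, hea z]
      generalize a z = A
      generalize b z = B
      generalize G (sliceHom I hI z₀) = C
      have hcomm : I * sliceHom I hI z₀ = sliceHom I hI z₀ * I := by
        have := sliceHom_mul_comm hI Complex.I z₀
        simpa [sliceHom_apply hI Complex.I] using this
      have e1 : C + (A + B * I) * sliceHom I hI (z - z₀) =
          (C + A * (z.re - sliceHom I hI z₀) - z.im • B) +
            (z.im • A + B * (z.re - sliceHom I hI z₀)) * I := by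
        rw [map_sub, sliceHom_apply hI z]
        simp only [mul_add, add_mul, mul_sub, sub_mul, mul_assoc, hI, hcomm, smul_mul_assoc,
          mul_smul_comm, Quaternion.coe_commutes, mul_neg, mul_one]
        module
      have e2 : C + (A + -B * I) * sliceHom I hI (starRingEnd ℂ z - z₀) =
          (C + A * (z.re - sliceHom I hI z₀) - z.im • B) -
            (z.im • A + B * (z.re - sliceHom I hI z₀)) * I := by
        rw [map_sub, sliceHom_conj hI z]
        simp only [add_mul, mul_sub, sub_mul, mul_assoc, hI, hcomm, smul_mul_assoc,
          mul_smul_comm, Quaternion.coe_commutes, neg_mul, mul_neg, mul_one]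
        module
      rw [e1, e2, sliceExt_eq hI, idSub, sliceHom_apply hJ z]
      simp only [mul_add, add_mul, mul_sub, sub_mul, mul_assoc, hJ, smul_mul_assoc,
          mul_smul_comm, Quaternion.coe_commutes, mul_neg, mul_one]
      module

/-! ### Iteration -/

/-- The skew derivative of a skew regular function is skew regular. -/
theorem SkewRegularOn.skewDeriv {U : Set ℍ[ℝ]} (hU : IsRegion U) {F : ℍ[ℝ] → ℍ[ℝ]}
    (hF : SkewRegularOn U F) : SkewRegularOn U (skewDeriv F) := by
  intro q hq
  obtain ⟨I, hI, hqI⟩ := exists_eq_sliceHom q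
  have h : ∀ z ∈ sliceHom I hI ⁻¹' U, ∃ d',
      HasSliceDerivAt I hI (fun w => SkewAnalysis.skewDeriv F (sliceHom I hI w)) d' z := fun z hz =>
    exists_hasSliceDerivAt_deriv (isOpen_preimage_sliceHom hU.1 hI)
      (fun w hw => hF.hasSliceDerivAt hU hI hw) hz
  rw [hqI] at hq ⊢
  obtain ⟨d, hd⟩ := h _ hq
  -- The conjugate point is needed because `E` near the sphere mixes the difference quotient at both
  -- points.
  obtain ⟨d', hd'⟩ := h _ (sliceHom_conj_mem hI hU.2 hq)
  exact skewDifferentiableAt_sliceHom (hF.isSliceOn_skewDeriv hU) (norm_nonneg _) hd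
    hd'.continuousAt

theorem SkewRegularOn.iteratedSkewDeriv {U : Set ℍ[ℝ]} (hU : IsRegion U) {F : ℍ[ℝ] → ℍ[ℝ]}
    (hF : SkewRegularOn U F) (n : ℕ) : SkewRegularOn U (iteratedSkewDeriv n F) := by
  induction n with
  | zero => exact hF
  | succ n ih =>
    rw [SkewAnalysis.iteratedSkewDeriv, Function.iterate_succ_apply']
    exact ih.skewDeriv hU

end SkewAnalysis

theorem mainTheorem11 (U : Set ℍ[ℝ]) (hU : SkewAnalysis.IsRegion U) (F : ℍ[ℝ] → ℍ[ℝ])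
    (hF : SkewAnalysis.SkewRegularOn U F) :
    SkewAnalysis.InfinitelySkewDifferentiableOn U F ∧
      SkewAnalysis.SkewRegularOn U (SkewAnalysis.skewDeriv F) := by
  refine ⟨fun n q hq => ⟨hF.iteratedSkewDeriv hU n q hq, ?_⟩, hF.skewDeriv hU⟩
  rw [SkewAnalysis.iteratedSkewDeriv, SkewAnalysis.iteratedSkewDeriv,
    Function.iterate_succ_apply']
  exact (hF.iteratedSkewDeriv hU n).hasSkewDerivAt hU hq
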